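/- Consider two bosonic modes, system (annihilation operator $a$) and environment ($b$), with Fock states $|m_1,m_2\rangle$, and put $U^\dagger(\cdot)U$ for the Heisenberg action of a Gaussian unitary $U$, whose global phase is fixed by $\langle 0,0|U|0,0\rangle>0$. Let $U$ be one of the following. (A) Two-mode squeezer, $\kappa\ge 1$: $U^\dagger aU=\kappa a+\sqrt{\kappa^2-1}\,b^\dagger$, $U^\dagger bU=\kappa b+\sqrt{\kappa^2-1}\,a^\dagger$. (B) Beam splitter, $0\le\kappa\le 1$: $U^\dagger aU=\kappa a-\sqrt{1-\kappa^2}\,b$, $U^\dagger bU=\sqrt{1-\kappa^2}\,a+\kappa b$. (C) Phase conjugator, $\kappa\ge 0$: $U^\dagger aU=\sqrt{1+\kappa^2}\,b+\kappa a^\dagger$, $U^\dagger bU=\sqrt{1+\kappa^2}\,a+\kappa b^\dagger$. Such a $U$ exists in each case. For $n\ge 0$ the $n$-photon-added amplifier, attenuator, and phase-conjugation channel, respectively, is $\rho\mapsto \mathrm{Tr}_E[U(\rho\otimes|n\rangle\langle n|)U^\dagger]$, with Kraus operators $F_\ell=\langle \ell|_E\,U\,|n\rangle_E$, $\ell=0,1,2,\dots$.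 **Proposition.** For every admissible $\kappa$ and all $n,\ell\ge 0$, the Kraus operators are \begin{align*} \text{(A)}\quad F_\ell&=\kappa^{-1}\sum_{j\ge\max\{0,n-\ell\}}\sqrt{\tfrac{j!\,\ell!}{(j+\ell-n)!\,n!}}\;g_1(n,j,j+\ell-n;\kappa)\,|j+\ell-n\rangle\langle j|,\\ \text{(B)}\quad F_\ell&=\sum_{j\ge\max\{0,\ell-n\}}\sqrt{\tfrac{(j+n-\ell)!\,\ell!}{j!\,n!}}\;g_2(n,\ell,j;\kappa)\,|j+n-\ell\rangle\langle j|,\\ \text{(C)}\quad F_\ell&=\tfrac{1}{\sqrt{1+\kappa^2}}\sum_{j=0}^{n+\ell}\sqrt{\tfrac{n!\,\ell!}{(\ell+n-j)!\,j!}}\;g_3(n,j,\ell+n-j;\kappa)\,|\ell+n-j\rangle\langle j|, \end{align*} and the positive operators $W_{\ell\ell}=F_\ell^\dagger F_\ell$ are diagonal in the Fock basis, explicitly \begin{align*} \text{(A)}\quad F_\ell^\dagger F_\ell&=\kappa^{-2}\sum_{j\ge\max\{0,n-\ell\}}\tfrac{j!\,\ell!}{(j+\ell-n)!\,n!}\;g_1(n,j,j+\ell-n;\kappa)^2\,|j\rangle\langle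 j|,\\ \text{(B)}\quad F_\ell^\dagger F_\ell&=\sum_{j\ge\max\{0,\ell-n\}}\tfrac{(j+n-\ell)!\,\ell!}{j!\,n!}\;g_2(n,\ell,j;\kappa)^2\,|j\rangle\langle j|,\\ \text{(C)}\quad F_\ell^\dagger F_\ell&=\tfrac{1}{1+\kappa^2}\sum_{j=0}^{n+\ell}\tfrac{n!\,\ell!}{(\ell+n-j)!\,j!}\;g_3(n,j,\ell+n-j;\kappa)^2\,|j\rangle\langle j|, \end{align*} with strong convergence of the sums. Here, with $0^0=1$, \begin{align*} g_1(n,n_1,m_1;\kappa)&=\sum_{r=\max\{0,n_1-m_1\}}^{\min\{n,n_1\}}\tbinom{n}{r}\tbinom{m_1}{n_1-r}(-1)^r\kappa^{-(n+n_1-2r)}\big(\sqrt{1-\kappa^{-2}}\big)^{m_1+2r-n_1},\\ g_2(n,\ell,n_1;\kappa)&=\sum_{r=\max\{0,\ell-n\}}^{\min\{\ell,n_1\}}\tbinom{n_1}{r}\tbinom{n}{\ell-r}(-1)^{n-\ell+r}\kappa^{n_1-2r+\ell}\big(\sqrt{1-\kappa^2}\big)^{2r+n-\ell},\\ g_3(n,n_1,m_1;\kappa)&=\sum_{r=\max\{0,n-n_1\}}^{\min\{n,m_1\}}\tbinom{m_1}{r}\tbinom{n_1}{n-r}(-1)^{n-r}\Big(\tfrac{\kappa}{\sqrt{1+\kappa^2}}\Big)^{m_1-2r+n}\Big(\tfrac{1}{\sqrt{1+\kappa^2}}\Big)^{n_1+2r-n}.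 \end{align*} -/

import Mathlib

open scoped Nat InnerProductSpace

noncomputable section

namespace PhotonAdded

/-- The Hilbert space of a single mode, realised on its Fock basis. -/
abbrev Mode : Type := lp (fun _ : ℕ => ℂ) 2

/-- The Hilbert space of two modes (system, environment), realised on the product Fock basis. -/
abbrev TwoMode : Type := lp (fun _ : ℕ × ℕ => ℂ) 2

/-- The Fock state `|j⟩` of a single mode. -/
def ket (j : ℕ) : Mode := lp.single 2 j (1 : ℂ)

/-- The Fock state `|p.1, p.2⟩`: `p.1` photons in the system and `p.2` in the environment. -/
def ket₂ (p : ℕ × ℕ) : TwoMode := lp.single 2 p (1 : ℂ)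

/-- Annihilation operators of the two modes (`0` is the system, `1` the environment),
evaluated on the Fock state `|p.1, p.2⟩`. -/
def annihilate (i : Fin 2) (p : ℕ × ℕ) : TwoMode :=
  if i = 0 then ((√(p.1 : ℝ) : ℝ) : ℂ) • ket₂ (p.1 - 1, p.2)
  else ((√(p.2 : ℝ) : ℝ) : ℂ) • ket₂ (p.1, p.2 - 1)

/-- Creation operators of the two modes, evaluated on the Fock state `|p.1, p.2⟩`. -/
def create (i : Fin 2) (p : ℕ × ℕ) : TwoMode :=
  if i = 0 then ((√((p.1 : ℝ) + 1) : ℝ) : ℂ) • ket₂ (p.1 + 1, p.2)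
  else ((√((p.2 : ℝ) + 1) : ℝ) : ℂ) • ket₂ (p.1, p.2 + 1)

/-- `U` is the Gaussian unitary inducing the linear canonical transformation
`U† aᵢ U = ∑ⱼ (α i j aⱼ + β i j aⱼ†)` (real coefficients). The relation `aᵢ U = U (⋯)` and its
adjoint version `aᵢ† U = U (⋯)` are imposed on the Fock states, in matrix elements, the unbounded
operator on the left being moved to the left-hand vector.
The global phase is fixed by making the vacuum amplitude positive. -/
structure IsGaussianUnitary (α β : Matrix (Fin 2) (Fin 2) ℝ) (U : TwoMode →L[ℂ] TwoMode) :
    Prop where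
  unitary : U ∈ unitary (TwoMode →L[ℂ] TwoMode)
  annihilate_comp : ∀ (i : Fin 2) (p q : ℕ × ℕ),
    ⟪create i p, U (ket₂ q)⟫_ℂ =
      ⟪ket₂ p, U (∑ j, (((α i j : ℝ) : ℂ) • annihilate j q + ((β i j : ℝ) : ℂ) • create j q))⟫_ℂ
  create_comp : ∀ (i : Fin 2) (p q : ℕ × ℕ),
    ⟪annihilate i p, U (ket₂ q)⟫_ℂ =
      ⟪ket₂ p, U (∑ j, (((α i j : ℝ) : ℂ) • create j q + ((β i j : ℝ) : ℂ) • annihilate j q))⟫_ℂ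
  vacuum : ∃ c : ℝ, 0 < c ∧ ⟪ket₂ (0, 0), U (ket₂ (0, 0))⟫_ℂ = (c : ℂ)

/-- The two-mode squeezer dilating the quantum-limited amplifier with parameter `κ ≥ 1`:
`U† a U = κ a + √(κ² - 1) b†` and `U† b U = κ b + √(κ² - 1) a†`. -/
def IsTwoModeSqueezer (κ : ℝ) (U : TwoMode →L[ℂ] TwoMode) : Prop :=
  IsGaussianUnitary !![κ, 0; 0, κ] !![0, √(κ ^ 2 - 1); √(κ ^ 2 - 1), 0] U

/-- The beam splitter dilating the quantum-limited attenuator with parameter `0 ≤ κ ≤ 1`: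
`U† a U = κ a - √(1 - κ²) b` and `U† b U = √(1 - κ²) a + κ b`. -/
def IsBeamSplitter (κ : ℝ) (U : TwoMode →L[ℂ] TwoMode) : Prop :=
  IsGaussianUnitary !![κ, -√(1 - κ ^ 2); √(1 - κ ^ 2), κ] 0 U

/-- The unitary dilating the quantum-limited phase conjugator with parameter `κ ≥ 0` (a two-mode
squeezer with parameter `√(1 + κ²)` combined with the mode flip):
`U† a U = √(1 + κ²) b + κ a†` and `U† b U = √(1 + κ²) a + κ b†`. -/
def IsPhaseConjugator (κ : ℝ) (U : TwoMode →L[ℂ] TwoMode) : Prop :=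
  IsGaussianUnitary !![0, √(1 + κ ^ 2); √(1 + κ ^ 2), 0] !![κ, 0; 0, κ] U

lemma norm_ket₂ (p : ℕ × ℕ) : ‖ket₂ p‖ = 1 := by
  simp [ket₂]

lemma orthogonalFamily_ket₂ (k : ℕ) :
    OrthogonalFamily ℂ (fun _ : ℕ => ℂ)
      (fun j => LinearIsometry.toSpanSingleton ℂ TwoMode (norm_ket₂ (j, k))) := by
  intro i j hij v w
  have h : (j, k) ≠ (i, k) := fun h => hij (congrArg Prod.fst h).symm
  simp [ket₂, inner_smul_left, inner_smul_right, lp.inner_single_left, h.symm]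

/-- The isometry `x ↦ x ⊗ |k⟩` appending the environment in the Fock state `|k⟩`. -/
def withEnv (k : ℕ) : Mode →L[ℂ] TwoMode :=
  (orthogonalFamily_ket₂ k).linearIsometry.toContinuousLinearMap

/-- The Kraus operator `F_ℓ = ⟨ℓ|_E U |n⟩_E` of the channel
`ρ ↦ Tr_E [U (ρ ⊗ |n⟩⟨n|) U†]`, the environment being traced out in its Fock basis. -/
def kraus (U : TwoMode →L[ℂ] TwoMode) (n ℓ : ℕ) : Mode →L[ℂ] Mode :=
  (withEnv ℓ).adjoint ∘L U ∘L withEnv n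

/-- The quadratic operator `W_ℓℓ = F_ℓ† F_ℓ`. -/
def quad (U : TwoMode →L[ℂ] TwoMode) (n ℓ : ℕ) : Mode →L[ℂ] Mode :=
  (kraus U n ℓ).adjoint ∘L kraus U n ℓ

/-- `W = ∑ⱼ w j |j⟩⟨j|`, the series converging strongly. -/
def IsFockDiagonal (W : Mode →L[ℂ] Mode) (w : ℕ → ℝ) : Prop :=
  ∀ x : Mode, HasSum (fun j => (((w j : ℝ) : ℂ) * ⟪ket j, x⟫_ℂ) • ket j) (W x)

/-- The polynomial factor in the Kraus operators of the photon-added amplifier. -/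
def g₁ (n n₁ m₁ : ℕ) (κ : ℝ) : ℝ :=
  ∑ r ∈ Finset.Icc (n₁ - m₁) (min n n₁),
    (n.choose r : ℝ) * (m₁.choose (n₁ - r) : ℝ) * (-1) ^ r * κ⁻¹ ^ (n + n₁ - 2 * r) *
      √(1 - κ⁻¹ ^ 2) ^ (m₁ + 2 * r - n₁)

/-- The polynomial factor in the Kraus operators of the photon-added attenuator. -/
def g₂ (n ℓ n₁ : ℕ) (κ : ℝ) : ℝ :=
  ∑ r ∈ Finset.Icc (ℓ - n) (min ℓ n₁),
    (n₁.choose r : ℝ) * (n.choose (ℓ - r) : ℝ) * (-1) ^ (n + r - ℓ) * κ ^ (n₁ + ℓ - 2 * r) *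
      √(1 - κ ^ 2) ^ (2 * r + n - ℓ)

/-- The polynomial factor in the Kraus operators of the photon-added phase conjugator.
Here `κ / √(1 + κ²)` is `1 / √(1 + κ⁻²)`, written so as to make sense at `κ = 0` too. -/
def g₃ (n n₁ m₁ : ℕ) (κ : ℝ) : ℝ :=
  ∑ r ∈ Finset.Icc (n - n₁) (min n m₁),
    (m₁.choose r : ℝ) * (n₁.choose (n - r) : ℝ) * (κ / √(1 + κ ^ 2)) ^ (m₁ + n - 2 * r) *
      (-1) ^ (n - r) * (√(1 + κ ^ 2))⁻¹ ^ (n₁ + 2 * r - n)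

end PhotonAdded

end

/-! A Gaussian unitary is determined by its Fock matrix elements `u p q = ⟨p|U|q⟩`, and the
Heisenberg relations are linear recurrences for them (`IsAmplitude`). When `α` is invertible, these
recurrences determine `u` up to a scalar (`IsAmplitude.eq_zero`): the creation relations give the
vacuum row by induction on the photon number, and the annihilation relations then give all other
rows. Normalisation and the positive vacuum amplitude fix the scalar, so it suffices to exhibit one
unitary solution in each case.

For the beam splitter the solution comes from rotating creation operators: up to factorials, `u p q`
is a coefficient of the dehomogenised polynomial `(c + sX)^q.1 (-s + cX)^q.2`. The squeezer follows
by crossing, which exchanges the system's input and output occupation numbers; the conjugator is the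
squeezer with its input modes swapped.

Unitarity is deduced from the recurrences themselves. The Gram matrix of the rows obeys the ladder
relations of the identity, because ladder operators can be moved across the inner product
(`IsAmplitude.gram`); rapid decay of the vacuum row makes all the series converge. The transposed
kernel solves the recurrences of the inverse transformation, so the columns are orthonormal too.

Finally, each kernel conserves the total or the difference of the photon numbers, up to a sign for
the conjugator. Hence `F_ℓ` sends each Fock state to a multiple of one Fock state, distinct inputs
going to distinct outputs, and `F_ℓ† F_ℓ` is diagonal. -/

noncomputable section

namespace PhotonAdded

/-! ### Occupation numbers of the two modes -/

/-- The number of photons in mode `i`. -/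
def num (i : Fin 2) (p : ℕ × ℕ) : ℕ := if i = 0 then p.1 else p.2

/-- Add a photon to mode `i`. -/
def inc (i : Fin 2) (p : ℕ × ℕ) : ℕ × ℕ := if i = 0 then (p.1 + 1, p.2) else (p.1, p.2 + 1)

/-- Remove a photon from mode `i` (no effect if the mode is empty). -/
def dec (i : Fin 2) (p : ℕ × ℕ) : ℕ × ℕ := if i = 0 then (p.1 - 1, p.2) else (p.1, p.2 - 1)

@[simp] lemma num_zero (p : ℕ × ℕ) : num 0 p = p.1 := rfl
@[simp] lemma num_one (p : ℕ × ℕ) : num 1 p = p.2 := rfl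
@[simp] lemma inc_zero (p : ℕ × ℕ) : inc 0 p = (p.1 + 1, p.2) := rfl
@[simp] lemma inc_one (p : ℕ × ℕ) : inc 1 p = (p.1, p.2 + 1) := rfl
@[simp] lemma dec_zero (p : ℕ × ℕ) : dec 0 p = (p.1 - 1, p.2) := rfl
@[simp] lemma dec_one (p : ℕ × ℕ) : dec 1 p = (p.1, p.2 - 1) := rfl

lemma inc_injective (i : Fin 2) : Function.Injective (inc i) := by
  intro p q h
  fin_cases i <;> simpa [Prod.ext_iff] using h

@[simp] lemma dec_inc (i : Fin 2) (p : ℕ × ℕ) : dec i (inc i p) = p := by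
  fin_cases i <;> simp

lemma inc_dec {i : Fin 2} {p : ℕ × ℕ} (h : num i p ≠ 0) : inc i (dec i p) = p := by
  fin_cases i <;> simp_all [Prod.ext_iff] <;> omega

@[simp] lemma num_inc (i : Fin 2) (p : ℕ × ℕ) : num i (inc i p) = num i p + 1 := by
  fin_cases i <;> simp

lemma num_le (i : Fin 2) (p : ℕ × ℕ) : num i p ≤ p.1 + p.2 := by
  fin_cases i <;> simp

lemma inc_fst_add_snd (i : Fin 2) (p : ℕ × ℕ) : (inc i p).1 + (inc i p).2 = p.1 + p.2 + 1 := by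
  fin_cases i <;> simp <;> omega

/-- Induction on the occupation numbers, adding one photon at a time. -/
lemma inc_induction {P : ℕ × ℕ → Prop} (h0 : P (0, 0)) (hinc : ∀ i p, P p → P (inc i p))
    (p : ℕ × ℕ) : P p := by
  obtain ⟨m, n⟩ := p
  induction m with
  | zero =>
    induction n with
    | zero => exact h0
    | succ n ih => exact hinc 1 _ ih
  | succ m ih => exact hinc 0 _ ih

/-! ### Real kernels intertwining the ladder operators -/

/-- The kernel `u` satisfies the recurrences obeyed by the matrix elements of a unitary that induces
the linear canonical transformation `aᵢ ↦ ∑ⱼ (α i j aⱼ + β i j aⱼ†)`. -/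
structure IsAmplitude (α β : Matrix (Fin 2) (Fin 2) ℝ) (u : ℕ × ℕ → ℕ × ℕ → ℝ) : Prop where
  ann : ∀ i p q, √((num i p : ℝ) + 1) * u (inc i p) q =
    ∑ j, (α i j * (√(num j q : ℝ) * u p (dec j q)) +
      β i j * (√((num j q : ℝ) + 1) * u p (inc j q)))
  cre : ∀ i p q, √(num i p : ℝ) * u (dec i p) q =
    ∑ j, (α i j * (√((num j q : ℝ) + 1) * u p (inc j q)) +
      β i j * (√(num j q : ℝ) * u p (dec j q)))

namespace IsAmplitude

variable {α β : Matrix (Fin 2) (Fin 2) ℝ} {u w : ℕ × ℕ → ℕ × ℕ → ℝ}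

/-- Linearity of the recurrences; it lets uniqueness follow from the vanishing criterion `eq_zero`.
-/
lemma sub_smul (hu : IsAmplitude α β u) (hw : IsAmplitude α β w) (d : ℝ) :
    IsAmplitude α β (fun p q => u p q - d * w p q) where
  ann i p q := by
    have h1 := hu.ann i p q
    have h2 := hw.ann i p q
    simp only [Fin.sum_univ_two] at *
    linear_combination h1 - d * h2
  cre i p q := by
    have h1 := hu.cre i p q
    have h2 := hw.cre i p q
    simp only [Fin.sum_univ_two] at *
    linear_combination h1 - d * h2

/-- The transposed kernel belongs to the inverse canonical transformation. -/
lemma transpose (hu : IsAmplitude α β u) (h1 : α.transpose * α - β.transpose * β = 1)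
    (h2 : α.transpose * β = β.transpose * α) :
    IsAmplitude α.transpose (-β.transpose) (fun p q => u q p) := by
  have e1 := fun i j => congrFun (congrFun h1 i) j
  have e2 := fun i j => congrFun (congrFun h2 i) j
  simp only [Matrix.sub_apply, Matrix.mul_apply, Matrix.transpose_apply, Fin.sum_univ_two,
    Matrix.one_apply] at e1 e2
  constructor
  all_goals
    intro i p q
    have a0 := hu.ann 0 q p
    have a1 := hu.ann 1 q p
    have c0 := hu.cre 0 q p
    have c1 := hu.cre 1 q p
    simp only [Fin.sum_univ_two] at a0 a1 c0 c1
    simp only [Matrix.transpose_apply, Matrix.neg_apply, Fin.sum_univ_two]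
    have e10 := e1 i 0
    have e11 := e1 i 1
    have e20 := e2 i 0
    have e21 := e2 i 1
  -- Substituting the recurrences of `u` leaves entries of `αᵀα - βᵀβ` and `αᵀβ - βᵀα`, which the
  -- hypotheses evaluate.
  · rw [c0, c1, a0, a1]
    fin_cases i <;>
    · simp at e10 e11 e20 e21 ⊢
      linear_combination (-(√((p.1 : ℝ) + 1) * u q (p.1 + 1, p.2))) * e10 -
        √((p.2 : ℝ) + 1) * u q (p.1, p.2 + 1) * e11 -
        √(p.1 : ℝ) * u q (p.1 - 1, p.2) * e20 - √(p.2 : ℝ) * u q (p.1, p.2 - 1) * e21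
  · rw [c0, c1, a0, a1]
    fin_cases i <;>
    · simp at e10 e11 e20 e21 ⊢
      linear_combination (-(√(p.1 : ℝ) * u q (p.1 - 1, p.2))) * e10 -
        √(p.2 : ℝ) * u q (p.1, p.2 - 1) * e11 -
        √((p.1 : ℝ) + 1) * u q (p.1 + 1, p.2) * e20 -
        √((p.2 : ℝ) + 1) * u q (p.1, p.2 + 1) * e21

/-- A kernel with vanishing vacuum amplitude vanishes. -/
lemma eq_zero (hu : IsAmplitude α β u) (hα : IsUnit α.det) (h0 : u (0, 0) (0, 0) = 0)
    (p q : ℕ × ℕ) : u p q = 0 := by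
  have row : ∀ N, ∀ q : ℕ × ℕ, q.1 + q.2 = N → u (0, 0) q = 0 := by
    intro N
    induction N using Nat.strong_induction_on with
    | _ N ih =>
      intro q hq
      by_cases hz : q = (0, 0)
      · rw [hz, h0]
      obtain ⟨i, hi⟩ : ∃ i, num i q ≠ 0 := by
        by_contra! h
        exact hz (Prod.ext (h 0) (h 1))
      obtain ⟨r, rfl⟩ : ∃ r, q = inc i r := ⟨dec i q, (inc_dec hi).symm⟩
      have hr : r.1 + r.2 < N := by rw [← hq, inc_fst_add_snd]; omega
      -- In the vacuum row the left side of the creation relation is zero and its `β` terms have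
      -- lower photon number, hence vanish by induction. So `α` kills the vector of next-level
      -- entries.
      have hv : α.mulVec (fun j => √((num j r : ℝ) + 1) * u (0, 0) (inc j r)) = 0 := by
        funext k
        have hk := hu.cre k (0, 0) r
        have hl : √(num k (0, 0) : ℝ) = 0 := by fin_cases k <;> simp
        rw [hl, zero_mul, Finset.sum_add_distrib] at hk
        have hs : ∑ j, β k j * (√(num j r : ℝ) * u (0, 0) (dec j r)) = 0 := by
          refine Finset.sum_eq_zero fun j _ => ?_
          by_cases hj : num j r = 0
          · simp [hj]
          · have := inc_fst_add_snd j (dec j r)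
            rw [inc_dec hj] at this
            rw [ih _ (by omega) (dec j r) rfl]
            simp
        rw [hs, add_zero] at hk
        simpa [Matrix.mulVec, dotProduct] using hk.symm
      have hz' := Matrix.mulVec_injective_iff_isUnit.mpr ((Matrix.isUnit_iff_isUnit_det α).mpr hα)
        (hv.trans (Matrix.mulVec_zero α).symm)
      have := congrFun hz' i
      have hne : √((num i r : ℝ) + 1) ≠ 0 := by positivity
      simpa [hne] using this
  induction p using inc_induction generalizing q with
  | h0 => exact row _ q rfl
  | hinc i p ih =>
    have h := hu.ann i p q
    simp only [ih, mul_zero, add_zero, Finset.sum_const_zero] at h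
    have hne : √((num i p : ℝ) + 1) ≠ 0 := by positivity
    simpa [hne] using h

end IsAmplitude

/-! ### Rapidly decreasing functions and orthonormality of the rows -/

/-- Rapidly decreasing functions of the occupation numbers. -/
def RapidDecay (f : ℕ × ℕ → ℝ) : Prop :=
  ∀ k : ℕ, Summable fun p : ℕ × ℕ => ((p.1 + p.2 + 1 : ℕ) : ℝ) ^ k * |f p|

/-- The action of the annihilation operator of mode `i` on Fock coefficients. -/
def lower (i : Fin 2) (f : ℕ × ℕ → ℝ) (p : ℕ × ℕ) : ℝ := √((num i p : ℝ) + 1) * f (inc i p)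

/-- The action of the creation operator of mode `i` on Fock coefficients. -/
def raise (i : Fin 2) (f : ℕ × ℕ → ℝ) (p : ℕ × ℕ) : ℝ := √(num i p : ℝ) * f (dec i p)

lemma support_raise_mul_subset (i : Fin 2) (f g : ℕ × ℕ → ℝ) :
    Function.support (fun p => raise i f p * g p) ⊆ Set.range (inc i) := by
  intro p hp
  by_contra h
  have : num i p = 0 := by
    by_contra h'
    exact h ⟨_, inc_dec h'⟩
  exact hp (by simp [raise, this])

/-- Creation and annihilation are mutually adjoint. No summability is required: `raise i f` vanishes
off the range of `inc i`, so this is a reindexing. -/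
lemma tsum_raise_mul (i : Fin 2) (f g : ℕ × ℕ → ℝ) :
    ∑' p, raise i f p * g p = ∑' p, f p * lower i g p := by
  rw [← (inc_injective i).tsum_eq (support_raise_mul_subset i f g)]
  refine tsum_congr fun p => ?_
  simp only [raise, lower, num_inc, dec_inc, Nat.cast_add, Nat.cast_one]
  ring

lemma sqrt_num_add_one_le (i : Fin 2) (p : ℕ × ℕ) :
    √((num i p : ℝ) + 1) ≤ ((p.1 + p.2 + 1 : ℕ) : ℝ) := by
  have h : (num i p : ℝ) ≤ ((p.1 + p.2 : ℕ) : ℝ) := by exact_mod_cast num_le i p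
  rw [Real.sqrt_le_iff]
  push_cast at h ⊢
  constructor
  · positivity
  · have h1 : (0 : ℝ) ≤ (p.1 : ℝ) + p.2 := by positivity
    nlinarith

namespace RapidDecay

variable {f g : ℕ × ℕ → ℝ}

lemma lower (hf : RapidDecay f) (i : Fin 2) : RapidDecay (lower i f) := by
  intro k
  refine Summable.of_nonneg_of_le (fun p => by positivity) (fun p => ?_)
    ((hf (k + 1)).comp_injective (inc_injective i))
  have h1 : ((p.1 + p.2 + 1 : ℕ) : ℝ) ≤ (((inc i p).1 + (inc i p).2 + 1 : ℕ) : ℝ) := by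
    rw [inc_fst_add_snd]; push_cast; linarith
  simp only [PhotonAdded.lower, Function.comp_apply, abs_mul, abs_of_nonneg (Real.sqrt_nonneg _)]
  rw [pow_succ, mul_assoc]
  gcongr
  exact (sqrt_num_add_one_le i p).trans h1

lemma raise (hf : RapidDecay f) (i : Fin 2) : RapidDecay (raise i f) := by
  intro k
  rw [← (inc_injective i).summable_iff]
  · refine Summable.of_nonneg_of_le (fun p => by simp only [Function.comp_apply]; positivity)
      (fun p => ?_) ((hf (k + 1)).mul_left (2 ^ k))
    simp only [Function.comp_apply, PhotonAdded.raise, num_inc, dec_inc, inc_fst_add_snd, abs_mul,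
      abs_of_nonneg (Real.sqrt_nonneg _)]
    have h1 : ((p.1 + p.2 + 1 + 1 : ℕ) : ℝ) ≤ 2 * ((p.1 + p.2 + 1 : ℕ) : ℝ) := by
      push_cast
      have : (0 : ℝ) ≤ (p.1 : ℝ) + p.2 := by positivity
      linarith
    have h2 := sqrt_num_add_one_le i p
    calc _ ≤ (2 * ((p.1 + p.2 + 1 : ℕ) : ℝ)) ^ k * (((p.1 + p.2 + 1 : ℕ) : ℝ) * |f p|) := by
            push_cast at h1 h2 ⊢
            gcongr
      _ = _ := by rw [mul_pow]; ring
  · intro p hp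
    have : num i p = 0 := by
      by_contra h'
      exact hp ⟨_, inc_dec h'⟩
    simp [PhotonAdded.raise, this]

lemma add (hf : RapidDecay f) (hg : RapidDecay g) : RapidDecay (fun p => f p + g p) := by
  intro k
  refine Summable.of_nonneg_of_le (fun p => by positivity) (fun p => ?_) ((hf k).add (hg k))
  rw [← mul_add]
  gcongr
  exact abs_add_le _ _

lemma const_mul (hf : RapidDecay f) (a : ℝ) : RapidDecay (fun p => a * f p) := by
  intro k
  refine ((hf k).mul_left |a|).congr fun p => ?_
  rw [abs_mul]; ring

lemma summable_mul (hf : RapidDecay f) (hg : RapidDecay g) : Summable fun p => f p * g p := by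
  have hf' : Summable fun p => |f p| := by simpa using hf 0
  have hg' : Summable fun p => |g p| := by simpa using hg 0
  refine Summable.of_norm_bounded (hf'.mul_right (∑' p, |g p|)) fun p => ?_
  rw [Real.norm_eq_abs, abs_mul]
  gcongr
  exact hg'.le_tsum p fun _ _ => abs_nonneg _

end RapidDecay

namespace IsAmplitude

variable {α β : Matrix (Fin 2) (Fin 2) ℝ} {u : ℕ × ℕ → ℕ × ℕ → ℝ}

lemma row_inc (hu : IsAmplitude α β u) (i : Fin 2) (p : ℕ × ℕ) :
    (fun q => √((num i p : ℝ) + 1) * u (inc i p) q) =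
      fun q => (α i 0 * raise 0 (u p) q + β i 0 * lower 0 (u p) q) +
        (α i 1 * raise 1 (u p) q + β i 1 * lower 1 (u p) q) := by
  funext q
  rw [hu.ann, Fin.sum_univ_two]
  rfl

lemma row_dec (hu : IsAmplitude α β u) (i : Fin 2) (p : ℕ × ℕ) :
    (fun q => √(num i p : ℝ) * u (dec i p) q) =
      fun q => (α i 0 * lower 0 (u p) q + β i 0 * raise 0 (u p) q) +
        (α i 1 * lower 1 (u p) q + β i 1 * raise 1 (u p) q) := by
  funext q
  rw [hu.cre, Fin.sum_univ_two]
  rfl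

/-- Each row is a finite combination of ladder operators applied to an earlier one, and these
operators cost only one power of the weight. -/
lemma rapidDecay (hu : IsAmplitude α β u) (h0 : RapidDecay (u (0, 0))) (p : ℕ × ℕ) :
    RapidDecay (u p) := by
  induction p using inc_induction with
  | h0 => exact h0
  | hinc i p ih =>
    have h : RapidDecay (fun q => √((num i p : ℝ) + 1) * u (inc i p) q) := by
      rw [hu.row_inc]
      exact (((ih.raise 0).const_mul _).add ((ih.lower 0).const_mul _)).add
        (((ih.raise 1).const_mul _).add ((ih.lower 1).const_mul _))
    have hne : √((num i p : ℝ) + 1) ≠ 0 := by positivity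
    have := h.const_mul (√((num i p : ℝ) + 1))⁻¹
    simpa [← mul_assoc, hne] using this

/-- Adding a photon to row `p` applies `∑ⱼ (α i j aⱼ† + β i j aⱼ)` to it. The adjoint of this
operator, acting on row `r`, removes a photon by the creation relation. -/
lemma gram_inc (hu : IsAmplitude α β u) (h0 : RapidDecay (u (0, 0))) (i : Fin 2) (p r : ℕ × ℕ) :
    √((num i p : ℝ) + 1) * ∑' q, u (inc i p) q * u r q =
      √(num i r : ℝ) * ∑' q, u p q * u (dec i r) q := by
  have hp := hu.rapidDecay h0 p
  have hr := hu.rapidDecay h0 r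
  have key1 := congrFun (hu.row_inc i p)
  have key2 := congrFun (hu.row_dec i r)
  rw [← tsum_mul_left, ← tsum_mul_left]
  simp only [← mul_assoc, key1]
  simp only [mul_comm (√(num i r : ℝ)), mul_assoc]
  have sR : ∀ j, Summable fun q => raise j (u p) q * u r q := fun j => (hp.raise j).summable_mul hr
  have sL : ∀ j, Summable fun q => lower j (u p) q * u r q := fun j => (hp.lower j).summable_mul hr
  have sR' : ∀ j, Summable fun q => u p q * raise j (u r) q := fun j => hp.summable_mul (hr.raise j)
  have sL' : ∀ j, Summable fun q => u p q * lower j (u r) q := fun j => hp.summable_mul (hr.lower j)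
  have e1 : ∀ j, ∑' q, raise j (u p) q * u r q = ∑' q, u p q * lower j (u r) q :=
    fun j => tsum_raise_mul j _ _
  have e2 : ∀ j, ∑' q, lower j (u p) q * u r q = ∑' q, u p q * raise j (u r) q := fun j => by
    have := tsum_raise_mul j (u r) (u p)
    simpa only [mul_comm] using this.symm
  have expand : ∀ (a b c d : ℝ) (A B C D : ℕ × ℕ → ℝ), Summable A → Summable B → Summable C →
      Summable D → ∑' q, ((a * A q + b * B q) + (c * C q + d * D q)) =
        (a * ∑' q, A q + b * ∑' q, B q) + (c * ∑' q, C q + d * ∑' q, D q) := by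
    intro a b c d A B C D hA hB hC hD
    exact ((((hA.hasSum.mul_left a).add (hB.hasSum.mul_left b)).add
      ((hC.hasSum.mul_left c).add (hD.hasSum.mul_left d)))).tsum_eq
  calc _ = ∑' q, ((α i 0 * (raise 0 (u p) q * u r q) + β i 0 * (lower 0 (u p) q * u r q)) +
        (α i 1 * (raise 1 (u p) q * u r q) + β i 1 * (lower 1 (u p) q * u r q))) :=
        tsum_congr fun q => by ring
    _ = ∑' q, ((α i 0 * (u p q * lower 0 (u r) q) + β i 0 * (u p q * raise 0 (u r) q)) +
        (α i 1 * (u p q * lower 1 (u r) q) + β i 1 * (u p q * raise 1 (u r) q))) := by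
        rw [expand _ _ _ _ _ _ _ _ (sR 0) (sL 0) (sR 1) (sL 1),
          expand _ _ _ _ _ _ _ _ (sL' 0) (sR' 0) (sL' 1) (sR' 1), e1, e1, e2, e2]
    _ = _ := tsum_congr fun q => by
        have := key2 q
        linear_combination (-u p q) * this

/-- The rows of an amplitude kernel with normalised vacuum row are orthonormal. -/
lemma gram (hu : IsAmplitude α β u) (h0 : RapidDecay (u (0, 0)))
    (h1 : ∑' q, u (0, 0) q ^ 2 = 1) (p r : ℕ × ℕ) :
    ∑' q, u p q * u r q = if p = r then 1 else 0 := by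
  have vac : ∀ i s, ∑' q, u (0, 0) q * u (inc i s) q = 0 := by
    intro i s
    have h := hu.gram_inc h0 i s (0, 0)
    have hl : √(num i (0, 0) : ℝ) = 0 := by fin_cases i <;> simp
    rw [hl, zero_mul] at h
    have hne : √((num i s : ℝ) + 1) ≠ 0 := by positivity
    simpa [hne, mul_comm] using h
  induction p using inc_induction generalizing r with
  | h0 =>
    by_cases hr : r = (0, 0)
    · simp [hr, ← h1, sq]
    · obtain ⟨i, hi⟩ : ∃ i, num i r ≠ 0 := by
        by_contra! h
        exact hr (Prod.ext (h 0) (h 1))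
      rw [if_neg (Ne.symm hr), ← inc_dec hi, vac]
  | hinc i p ih =>
    have h := hu.gram_inc h0 i p r
    have hne : √((num i p : ℝ) + 1) ≠ 0 := by positivity
    rw [ih] at h
    by_cases hi : num i r = 0
    · have : inc i p ≠ r := by rintro rfl; simp at hi
      rw [if_neg this]
      simpa [hi, hne] using h
    · obtain ⟨s, rfl⟩ : ∃ s, r = inc i s := ⟨dec i r, (inc_dec hi).symm⟩
      rw [dec_inc, num_inc] at h
      simp only [(inc_injective i).eq_iff]
      refine mul_left_cancel₀ hne (h.trans ?_)
      by_cases hps : p = s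
      · simp [hps]
      · simp [hps]

end IsAmplitude

open Polynomial

/-! ### Explicit kernels -/

/-- `(c + s X) ^ q.1 * (- s + c X) ^ q.2`. -/
def transferPoly (c s : ℝ) (q : ℕ × ℕ) : ℝ[X] :=
  (C c + C s * X) ^ q.1 * (C (-s) + C c * X) ^ q.2

/-- The matrix elements of the beam splitter, up to the factorials. -/
def transferCoeff (c s : ℝ) (p q : ℕ × ℕ) : ℝ :=
  if p.1 + p.2 = q.1 + q.2 then (transferPoly c s q).coeff p.2 else 0

/-- The norm of `a†^p.1 b†^p.2 |0,0⟩`. -/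
def fockNorm (p : ℕ × ℕ) : ℝ := √((p.1 ! : ℝ) * (p.2 ! : ℝ))

/-- The matrix elements of the beam splitter. -/
def beamAmplitude (c s : ℝ) (p q : ℕ × ℕ) : ℝ :=
  fockNorm p / fockNorm q * transferCoeff c s p q

/-- The matrix elements of the two-mode squeezer. -/
def squeezeAmplitude (c t : ℝ) (p q : ℕ × ℕ) : ℝ :=
  c * beamAmplitude c (-t) (p.2, q.1) (q.2, p.1)

/-- The matrix elements of the phase conjugator. -/
def conjAmplitude (c t : ℝ) (p q : ℕ × ℕ) : ℝ := squeezeAmplitude c t p q.swap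

lemma fockNorm_pos (p : ℕ × ℕ) : 0 < fockNorm p := by unfold fockNorm; positivity

lemma fockNorm_inc (i : Fin 2) (p : ℕ × ℕ) :
    fockNorm (inc i p) = √((num i p : ℝ) + 1) * fockNorm p := by
  unfold fockNorm
  rw [← Real.sqrt_mul (by positivity)]
  congr 1
  fin_cases i <;> simp [Nat.factorial_succ] <;> ring

lemma natDegree_transferPoly_le (c s : ℝ) (q : ℕ × ℕ) :
    (transferPoly c s q).natDegree ≤ q.1 + q.2 := by
  unfold transferPoly
  compute_degree

/-- This identity and `transferPoly_eq_right` invert the rotation: they write `1` and `X`, the two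
dehomogenised variables, in terms of the linear factors, and so yield the creation relations. -/
lemma transferPoly_eq_left {c s : ℝ} (h : c ^ 2 + s ^ 2 = 1) (q : ℕ × ℕ) :
    transferPoly c s q = C c * transferPoly c s (inc 0 q) - C s * transferPoly c s (inc 1 q) := by
  have h' : (C c) ^ 2 + (C s) ^ 2 = (1 : ℝ[X]) := by rw [← C_pow, ← C_pow, ← C_add, h, C_1]
  simp only [transferPoly, inc_zero, inc_one, pow_succ, C_neg]
  linear_combination (-(C c + C s * X) ^ q.1 * (-C s + C c * X) ^ q.2) * h'

lemma transferPoly_eq_right {c s : ℝ} (h : c ^ 2 + s ^ 2 = 1) (q : ℕ × ℕ) :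
    X * transferPoly c s q =
      C s * transferPoly c s (inc 0 q) + C c * transferPoly c s (inc 1 q) := by
  have h' : (C c) ^ 2 + (C s) ^ 2 = (1 : ℝ[X]) := by rw [← C_pow, ← C_pow, ← C_add, h, C_1]
  simp only [transferPoly, inc_zero, inc_one, pow_succ, C_neg]
  linear_combination (-X * (C c + C s * X) ^ q.1 * (-C s + C c * X) ^ q.2) * h'

lemma derivative_transferPoly (c s : ℝ) (q : ℕ × ℕ) :
    derivative (transferPoly c s q) = C (s * q.1) * transferPoly c s (dec 0 q) +
      C (c * q.2) * transferPoly c s (dec 1 q) := by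
  simp only [transferPoly, dec_zero, dec_one, derivative_mul, derivative_pow, derivative_add,
    derivative_C, derivative_X, C_mul, map_natCast]
  ring

/-- Euler's identity for a form of degree `q.1 + q.2`: the left side is the derivative in the
variable set to `1`, so it plays the part of annihilation in the first mode. -/
lemma euler_transferPoly (c s : ℝ) (q : ℕ × ℕ) :
    C ((q.1 + q.2 : ℕ) : ℝ) * transferPoly c s q - X * derivative (transferPoly c s q) =
      C (c * q.1) * transferPoly c s (dec 0 q) - C (s * q.2) * transferPoly c s (dec 1 q) := by
  rw [derivative_transferPoly]
  obtain ⟨m, n⟩ := q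
  rcases m with _ | m <;> rcases n with _ | n <;>
  · simp only [transferPoly, dec_zero, dec_one, C_mul, map_natCast, C_neg, pow_succ,
      Nat.add_sub_cancel]
    push_cast
    ring

section Transfer

variable {c s : ℝ} (p q : ℕ × ℕ)

lemma transferCoeff_ann_zero :
    ((p.1 : ℝ) + 1) * transferCoeff c s (inc 0 p) q =
      c * (q.1 * transferCoeff c s p (dec 0 q)) - s * (q.2 * transferCoeff c s p (dec 1 q)) := by
  -- All terms are put under one conservation condition; where truncated subtraction would spoil it,
  -- the factor `num j q` is zero.
  have hd : ∀ j : Fin 2, (num j q : ℝ) * transferCoeff c s p (dec j q) =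
      if (inc 0 p).1 + (inc 0 p).2 = q.1 + q.2 then
        num j q * (transferPoly c s (dec j q)).coeff p.2 else 0 := by
    intro j
    by_cases hj : num j q = 0
    · simp [hj]
    · have := inc_fst_add_snd j (dec j q)
      rw [inc_dec hj] at this
      rw [transferCoeff, mul_ite, mul_zero, inc_fst_add_snd, this]
      simp
  have h0 := hd 0
  have h1 := hd 1
  simp only [num_zero, num_one] at h0 h1
  rw [h0, h1, transferCoeff]
  split_ifs with h
  · have e := congrArg (fun P => coeff P p.2) (euler_transferPoly c s q)
    simp only [coeff_sub, coeff_C_mul] at e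
    have hX : (X * derivative (transferPoly c s q)).coeff p.2 =
        p.2 * (transferPoly c s q).coeff p.2 := by
      rcases p.2 with _ | n
      · simp
      · rw [coeff_X_mul, coeff_derivative]; push_cast; ring
    rw [hX, ← h] at e
    simp only [inc_zero] at e ⊢
    push_cast at e
    linear_combination e
  · simp

lemma transferCoeff_ann_one :
    ((p.2 : ℝ) + 1) * transferCoeff c s (inc 1 p) q =
      s * (q.1 * transferCoeff c s p (dec 0 q)) + c * (q.2 * transferCoeff c s p (dec 1 q)) := by
  have hd : ∀ j : Fin 2, (num j q : ℝ) * transferCoeff c s p (dec j q) =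
      if (inc 1 p).1 + (inc 1 p).2 = q.1 + q.2 then
        num j q * (transferPoly c s (dec j q)).coeff p.2 else 0 := by
    intro j
    by_cases hj : num j q = 0
    · simp [hj]
    · have := inc_fst_add_snd j (dec j q)
      rw [inc_dec hj] at this
      rw [transferCoeff, mul_ite, mul_zero, inc_fst_add_snd, this]
      simp
  have h0 := hd 0
  have h1 := hd 1
  simp only [num_zero, num_one] at h0 h1
  rw [h0, h1, transferCoeff]
  split_ifs with h
  · have e := congrArg (fun P => coeff P p.2) (derivative_transferPoly c s q)
    simp only [coeff_add, coeff_C_mul, coeff_derivative] at e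
    simp only [inc_one] at e ⊢
    linear_combination e
  · simp

lemma transferCoeff_cre_zero (h : c ^ 2 + s ^ 2 = 1) :
    (if p.1 = 0 then 0 else transferCoeff c s (dec 0 p) q) =
      c * transferCoeff c s p (inc 0 q) - s * transferCoeff c s p (inc 1 q) := by
  have e := congrArg (fun P => coeff P p.2) (transferPoly_eq_left h q)
  simp only [coeff_sub, coeff_C_mul] at e
  simp only [transferCoeff, inc_fst_add_snd]
  by_cases hN : p.1 + p.2 = q.1 + q.2 + 1
  · simp only [hN, if_true]
    rw [← e]
    by_cases hp : p.1 = 0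
    -- Here `p.2 = q.1 + q.2 + 1` exceeds the degree.
    · rw [if_pos hp, coeff_eq_zero_of_natDegree_lt]
      have := natDegree_transferPoly_le c s q
      omega
    · rw [if_neg hp, if_pos]
      · rfl
      · simp only [dec_zero]; omega
  · simp only [if_neg hN]
    split_ifs with h1 h2
    · simp
    · simp only [dec_zero] at h2; omega
    · simp

lemma transferCoeff_cre_one (h : c ^ 2 + s ^ 2 = 1) :
    (if p.2 = 0 then 0 else transferCoeff c s (dec 1 p) q) =
      s * transferCoeff c s p (inc 0 q) + c * transferCoeff c s p (inc 1 q) := by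
  have e := congrArg (fun P => coeff P p.2) (transferPoly_eq_right h q)
  simp only [coeff_add, coeff_C_mul] at e
  simp only [transferCoeff, inc_fst_add_snd]
  obtain ⟨m, n⟩ := p
  rcases n with _ | n
  · simp only [mul_coeff_zero, coeff_X_zero, zero_mul] at e
    rw [if_pos rfl]
    split_ifs
    · exact e
    · simp
  · simp only [coeff_X_mul] at e
    simp only [dec_one, Nat.add_sub_cancel, Nat.add_eq_zero_iff, one_ne_zero, and_false, if_false]
    by_cases hN : m + n = q.1 + q.2
    · rw [if_pos hN, if_pos (by omega), if_pos (by omega), e]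
    · rw [if_neg hN, if_neg (by omega), if_neg (by omega)]; simp

end Transfer

section Normalisation

variable (c s : ℝ) (i : Fin 2) (p q : ℕ × ℕ)

/-- The ratio of Fock norms absorbs the square roots, so that this lemma and the next three reduce
the ladder recurrences to those of `transferCoeff`. -/
lemma sqrt_mul_beamAmplitude_inc_left : √((num i p : ℝ) + 1) * beamAmplitude c s (inc i p) q =
    fockNorm p / fockNorm q * (((num i p : ℝ) + 1) * transferCoeff c s (inc i p) q) := by
  rw [beamAmplitude, fockNorm_inc]
  have := Real.mul_self_sqrt (show (0 : ℝ) ≤ (num i p : ℝ) + 1 by positivity)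
  linear_combination (fockNorm p / fockNorm q * transferCoeff c s (inc i p) q) * this

lemma sqrt_mul_beamAmplitude_inc_right : √((num i q : ℝ) + 1) * beamAmplitude c s p (inc i q) =
    fockNorm p / fockNorm q * transferCoeff c s p (inc i q) := by
  rw [beamAmplitude, fockNorm_inc]
  have hq := (fockNorm_pos q).ne'
  have : √((num i q : ℝ) + 1) ≠ 0 := by positivity
  field_simp

lemma sqrt_mul_beamAmplitude_dec_right : √(num i q : ℝ) * beamAmplitude c s p (dec i q) =
    fockNorm p / fockNorm q * (num i q * transferCoeff c s p (dec i q)) := by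
  by_cases hi : num i q = 0
  · simp [hi]
  · obtain ⟨r, rfl⟩ : ∃ r, q = inc i r := ⟨dec i q, (inc_dec hi).symm⟩
    rw [dec_inc, beamAmplitude, fockNorm_inc, num_inc, Nat.cast_add, Nat.cast_one]
    have hq := (fockNorm_pos r).ne'
    have h1 : √((num i r : ℝ) + 1) ≠ 0 := by positivity
    have := Real.sq_sqrt (show (0 : ℝ) ≤ (num i r : ℝ) + 1 by positivity)
    field_simp
    rw [this]

lemma sqrt_mul_beamAmplitude_dec_left : √(num i p : ℝ) * beamAmplitude c s (dec i p) q =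
    fockNorm p / fockNorm q * (if num i p = 0 then 0 else transferCoeff c s (dec i p) q) := by
  by_cases hi : num i p = 0
  · simp [hi]
  · obtain ⟨r, rfl⟩ : ∃ r, p = inc i r := ⟨dec i p, (inc_dec hi).symm⟩
    rw [dec_inc, beamAmplitude, fockNorm_inc, num_inc, Nat.cast_add, Nat.cast_one, if_neg (by omega)]
    ring

end Normalisation

lemma isAmplitude_beamAmplitude {c s : ℝ} (h : c ^ 2 + s ^ 2 = 1) :
    IsAmplitude !![c, -s; s, c] 0 (beamAmplitude c s) where
  ann i p q := by
    simp only [sqrt_mul_beamAmplitude_inc_left, sqrt_mul_beamAmplitude_dec_right, Fin.sum_univ_two]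
    fin_cases i
    · have := transferCoeff_ann_zero (c := c) (s := s) p q
      simp at this ⊢
      linear_combination (fockNorm p / fockNorm q) * this
    · have := transferCoeff_ann_one (c := c) (s := s) p q
      simp at this ⊢
      linear_combination (fockNorm p / fockNorm q) * this
  cre i p q := by
    simp only [sqrt_mul_beamAmplitude_dec_left, sqrt_mul_beamAmplitude_inc_right, Fin.sum_univ_two]
    match i with
    | 0 =>
      rw [num_zero, transferCoeff_cre_zero p q h]
      simp
      ring
    | 1 =>
      rw [num_one, transferCoeff_cre_one p q h]
      simp
      ring

/-- Crossing turns a beam splitter relation into a squeezer relation solved for a different term.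
Two of the four follow from a single relation; the others combine two of them with `c ^ 2 + t ^ 2 =
1`. -/
lemma isAmplitude_squeezeAmplitude {c t : ℝ} (hc : c ≠ 0) (h : c ^ 2 + t ^ 2 = 1) :
    IsAmplitude !![c⁻¹, 0; 0, c⁻¹] !![0, t * c⁻¹; t * c⁻¹, 0] (squeezeAmplitude c t) := by
  have hB := isAmplitude_beamAmplitude (c := c) (s := -t) (by simpa using h)
  constructor
  all_goals
    intro i p q
    have a0 := hB.ann 0 (p.2, q.1) (q.2, p.1)
    have a1 := hB.ann 1 (p.2, q.1) (q.2, p.1)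
    have c0 := hB.cre 0 (p.2, q.1) (q.2, p.1)
    have c1 := hB.cre 1 (p.2, q.1) (q.2, p.1)
    simp [Fin.sum_univ_two] at a0 a1 c0 c1
    fin_cases i <;> simp [Fin.sum_univ_two, squeezeAmplitude] <;> field_simp
  · linear_combination -c1
  · linear_combination c * a0 - t * a1 +
      √(q.2 : ℝ) * beamAmplitude c (-t) (p.2, q.1) (q.2 - 1, p.1) * h
  · linear_combination -a1
  · linear_combination c * c0 - t * c1 +
      √((q.2 : ℝ) + 1) * beamAmplitude c (-t) (p.2, q.1) (q.2 + 1, p.1) * h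

/-- Swapping the input modes exchanges the columns of `α` and of `β`. -/
lemma isAmplitude_conjAmplitude {c t : ℝ} (hc : c ≠ 0) (h : c ^ 2 + t ^ 2 = 1) :
    IsAmplitude !![0, c⁻¹; c⁻¹, 0] !![t * c⁻¹, 0; 0, t * c⁻¹] (conjAmplitude c t) := by
  have hS := isAmplitude_squeezeAmplitude hc h
  constructor
  · intro i p q
    have := hS.ann i p q.swap
    fin_cases i <;> simp [Fin.sum_univ_two, conjAmplitude] at this ⊢ <;> linear_combination this
  · intro i p q
    have := hS.cre i p q.swap
    fin_cases i <;> simp [Fin.sum_univ_two, conjAmplitude] at this ⊢ <;> linear_combination this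

/-! ### Closed forms of the coefficients -/

lemma coeff_linear_pow (a b : ℝ) (n r : ℕ) :
    ((C a + C b * X) ^ n).coeff r = n.choose r * a ^ (n - r) * b ^ r := by
  have : (C a + C b * X) ^ n = ((X + C a) ^ n).comp (C b * X) := by simp [add_comm]
  rw [this, comp_C_mul_X_coeff, coeff_X_add_C_pow]
  ring

/-- Cauchy product; outside the stated range of `r` a binomial coefficient vanishes. -/
lemma coeff_linear_pow_mul (a b a' b' : ℝ) (n m j : ℕ) :
    ((C a + C b * X) ^ n * (C a' + C b' * X) ^ m).coeff j =
      ∑ r ∈ Finset.Icc (j - m) (min n j), (n.choose r : ℝ) * a ^ (n - r) * b ^ r *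
        (m.choose (j - r) * a' ^ (m - (j - r)) * b' ^ (j - r)) := by
  rw [coeff_mul]
  refine (Finset.Nat.sum_antidiagonal_eq_sum_range_succ
    (fun x y => ((C a + C b * X) ^ n).coeff x * ((C a' + C b' * X) ^ m).coeff y) j).trans ?_
  simp only [coeff_linear_pow]
  symm
  refine Finset.sum_subset (fun r hr => ?_) (fun r hr hr' => ?_)
  · simp only [Finset.mem_Icc, Finset.mem_range] at hr ⊢
    omega
  · simp only [Finset.mem_Icc, Finset.mem_range, not_and_or, not_le] at hr hr'
    rcases hr' with h | h
    · rw [Nat.choose_eq_zero_of_lt (show m < j - r by omega)]; simp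
    · rw [Nat.choose_eq_zero_of_lt (show n < r by omega)]; simp

lemma g₁_eq (n j m : ℕ) (κ : ℝ) :
    g₁ n j m κ = (transferPoly κ⁻¹ (-√(1 - κ⁻¹ ^ 2)) (n, m)).coeff j := by
  rw [transferPoly, neg_neg, coeff_linear_pow_mul, g₁]
  refine Finset.sum_congr rfl fun r hr => ?_
  rw [Finset.mem_Icc] at hr
  rw [show n + j - 2 * r = (n - r) + (j - r) by omega, neg_pow]
  by_cases hm : m < j - r
  · simp [Nat.choose_eq_zero_of_lt hm]
  rw [show m + 2 * r - j = r + (m - (j - r)) by omega, pow_add, pow_add]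
  ring

lemma g₂_eq (n ℓ j : ℕ) (κ : ℝ) :
    g₂ n ℓ j κ = (transferPoly κ √(1 - κ ^ 2) (j, n)).coeff ℓ := by
  rw [transferPoly, coeff_linear_pow_mul, g₂, min_comm]
  refine Finset.sum_congr rfl fun r hr => ?_
  rw [Finset.mem_Icc] at hr
  rw [show j + ℓ - 2 * r = (j - r) + (ℓ - r) by omega,
    show 2 * r + n - ℓ = r + (n - (ℓ - r)) by omega, show n + r - ℓ = n - (ℓ - r) by omega,
    neg_pow √(1 - κ ^ 2), pow_add, pow_add]
  ring

/-- The factors are commuted because the index `r` in `g₃` counts powers of `X` taken from the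
second factor, the one with exponent `m`. -/
lemma g₃_eq (n j m : ℕ) (κ : ℝ) :
    g₃ n j m κ = (transferPoly (√(1 + κ ^ 2))⁻¹ (-(κ / √(1 + κ ^ 2))) (j, m)).coeff n := by
  rw [transferPoly, neg_neg, mul_comm, coeff_linear_pow_mul, g₃, min_comm]
  refine Finset.sum_congr rfl fun r hr => ?_
  rw [Finset.mem_Icc] at hr
  rw [show m + n - 2 * r = (m - r) + (n - r) by omega,
    show j + 2 * r - n = r + (j - (n - r)) by omega, neg_pow (κ / √(1 + κ ^ 2)), pow_add, pow_add]
  ring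

/-! ### Fock states -/

lemma inner_ket₂_left (p : ℕ × ℕ) (x : TwoMode) : ⟪ket₂ p, x⟫_ℂ = x p := by
  simp [ket₂, lp.inner_single_left]

lemma inner_ket_left (j : ℕ) (x : Mode) : ⟪ket j, x⟫_ℂ = x j := by
  simp [ket, lp.inner_single_left]

lemma ket_apply (i j : ℕ) : ket i j = if j = i then 1 else 0 := by
  simp [ket, lp.single_apply, Pi.single_apply]

lemma hasSum_ket₂ (x : TwoMode) : HasSum (fun p => x p • ket₂ p) x := by
  refine (lp.hasSum_single (by simp) x).congr_fun fun p => ?_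
  simp [ket₂, ← lp.single_smul]

lemma hasSum_ket (x : Mode) : HasSum (fun j => x j • ket j) x := by
  refine (lp.hasSum_single (by simp) x).congr_fun fun j => ?_
  simp [ket, ← lp.single_smul]

lemma ext_ket₂ {S T : TwoMode →L[ℂ] TwoMode} (h : ∀ p, S (ket₂ p) = T (ket₂ p)) : S = T := by
  ext1 x
  have hS := (hasSum_ket₂ x).mapL S
  have hT := (hasSum_ket₂ x).mapL T
  simp only [map_smul, h] at hS hT
  exact hS.unique hT

lemma create_eq (i : Fin 2) (p : ℕ × ℕ) :
    create i p = ((√((num i p : ℝ) + 1) : ℝ) : ℂ) • ket₂ (inc i p) := by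
  fin_cases i <;> simp [create]

lemma annihilate_eq (i : Fin 2) (p : ℕ × ℕ) :
    annihilate i p = ((√(num i p : ℝ) : ℝ) : ℂ) • ket₂ (dec i p) := by
  fin_cases i <;> simp [annihilate]

/-! ### Gaussian unitaries and their kernels -/

section Kernel

variable {α β : Matrix (Fin 2) (Fin 2) ℝ} {u : ℕ × ℕ → ℕ × ℕ → ℝ} {U : TwoMode →L[ℂ] TwoMode}

lemma isGaussianUnitary_of_isAmplitude (hU : U ∈ unitary (TwoMode →L[ℂ] TwoMode))
    (h : ∀ p q, ⟪ket₂ p, U (ket₂ q)⟫_ℂ = (u p q : ℂ)) (hu : IsAmplitude α β u)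
    (h0 : 0 < u (0, 0) (0, 0)) : IsGaussianUnitary α β U where
  unitary := hU
  annihilate_comp i p q := by
    have := congrArg (fun x : ℝ => (x : ℂ)) (hu.ann i p q)
    simpa only [create_eq, annihilate_eq, map_sum, map_add, map_smul, inner_sum, inner_add_right,
      inner_smul_right, inner_smul_left, Complex.conj_ofReal, h, Complex.ofReal_sum,
      Complex.ofReal_add, Complex.ofReal_mul] using this
  create_comp i p q := by
    have := congrArg (fun x : ℝ => (x : ℂ)) (hu.cre i p q)
    simpa only [create_eq, annihilate_eq, map_sum, map_add, map_smul, inner_sum, inner_add_right,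
      inner_smul_right, inner_smul_left, Complex.conj_ofReal, h, Complex.ofReal_sum,
      Complex.ofReal_add, Complex.ofReal_mul] using this
  vacuum := ⟨_, h0, h _ _⟩

/-- The coefficients are real, so real and imaginary parts obey the recurrences separately. -/
lemma IsGaussianUnitary.isAmplitude_re (hU : IsGaussianUnitary α β U) :
    IsAmplitude α β (fun p q => (⟪ket₂ p, U (ket₂ q)⟫_ℂ).re) where
  ann i p q := by
    have := congrArg Complex.re (hU.annihilate_comp i p q)
    simpa only [create_eq, annihilate_eq, map_sum, map_add, map_smul, inner_sum, inner_add_right,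
      inner_smul_right, inner_smul_left, Complex.conj_ofReal, Complex.re_sum,
      Complex.add_re, Complex.re_ofReal_mul] using this
  cre i p q := by
    have := congrArg Complex.re (hU.create_comp i p q)
    simpa only [create_eq, annihilate_eq, map_sum, map_add, map_smul, inner_sum, inner_add_right,
      inner_smul_right, inner_smul_left, Complex.conj_ofReal, Complex.re_sum,
      Complex.add_re, Complex.re_ofReal_mul] using this

lemma IsGaussianUnitary.isAmplitude_im (hU : IsGaussianUnitary α β U) :
    IsAmplitude α β (fun p q => (⟪ket₂ p, U (ket₂ q)⟫_ℂ).im) where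
  ann i p q := by
    have := congrArg Complex.im (hU.annihilate_comp i p q)
    simpa only [create_eq, annihilate_eq, map_sum, map_add, map_smul, inner_sum, inner_add_right,
      inner_smul_right, inner_smul_left, Complex.conj_ofReal, Complex.im_sum,
      Complex.add_im, Complex.im_ofReal_mul] using this
  cre i p q := by
    have := congrArg Complex.im (hU.create_comp i p q)
    simpa only [create_eq, annihilate_eq, map_sum, map_add, map_smul, inner_sum, inner_add_right,
      inner_smul_right, inner_smul_left, Complex.conj_ofReal, Complex.im_sum,
      Complex.add_im, Complex.im_ofReal_mul] using this

/-- A real matrix with orthonormal rows is the transpose of the matrix of an isometry. -/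
lemma exists_isometry_of_gram {w : ℕ × ℕ → ℕ × ℕ → ℝ} (hs : ∀ p, Summable fun q => w p q * w p q)
    (hg : ∀ p r, ∑' q, w p q * w r q = if p = r then 1 else 0) :
    ∃ V : TwoMode →ₗᵢ[ℂ] TwoMode, ∀ p q, ⟪ket₂ q, V (ket₂ p)⟫_ℂ = (w p q : ℂ) := by
  let v : ℕ × ℕ → TwoMode := fun p => ⟨fun q => (w p q : ℂ), memℓp_gen (by
    simpa [← sq] using hs p)⟩
  have hv : ∀ p r, ⟪v p, v r⟫_ℂ = if p = r then 1 else 0 := by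
    intro p r
    rw [lp.inner_eq_tsum]
    have : ∀ q, ⟪v p q, v r q⟫_ℂ = ((w p q * w r q : ℝ) : ℂ) := fun q => by
      simp [v, mul_comm]
    rw [tsum_congr this, ← Complex.ofReal_tsum, hg]
    split_ifs <;> simp
  have hn : ∀ p, ‖v p‖ = 1 := fun p => by
    rw [← sq_eq_sq₀ (norm_nonneg _) zero_le_one, one_pow]
    have h := inner_self_eq_norm_sq_to_K (𝕜 := ℂ) (v p)
    rw [hv, if_pos rfl] at h
    exact Complex.ofReal_injective (by simpa using h.symm)
  have ho : OrthogonalFamily ℂ (fun _ : ℕ × ℕ => ℂ)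
      (fun p => LinearIsometry.toSpanSingleton ℂ TwoMode (hn p)) := by
    intro p r hpr a b
    simp [inner_smul_left, inner_smul_right, hv, hpr]
  refine ⟨ho.linearIsometry, fun p q => ?_⟩
  rw [inner_ket₂_left, ket₂, ho.linearIsometry_apply_single]
  simp [v]

/-- The data from which the Gaussian unitary with kernel `u` is built. -/
structure IsGaussianKernel (α β : Matrix (Fin 2) (Fin 2) ℝ) (u : ℕ × ℕ → ℕ × ℕ → ℝ) : Prop where
  amplitude : IsAmplitude α β u
  symplectic : α.transpose * α - β.transpose * β = 1
  symmetric : α.transpose * β = β.transpose * α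
  isUnit_det : IsUnit α.det
  vacuum_pos : 0 < u (0, 0) (0, 0)
  row_decay : RapidDecay (u (0, 0))
  row_norm : ∑' q, u (0, 0) q ^ 2 = 1
  col_decay : RapidDecay (fun p => u p (0, 0))
  col_norm : ∑' p, u p (0, 0) ^ 2 = 1

namespace IsGaussianKernel

lemma exists_unitary (hu : IsGaussianKernel α β u) : ∃ U, IsGaussianUnitary α β U := by
  have ht := hu.amplitude.transpose hu.symplectic hu.symmetric
  obtain ⟨V, hV⟩ := exists_isometry_of_gram
    (fun p => (ht.rapidDecay hu.col_decay p).summable_mul (ht.rapidDecay hu.col_decay p))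
    (ht.gram hu.col_decay hu.col_norm)
  obtain ⟨W, hW⟩ := exists_isometry_of_gram
    (fun p => (hu.amplitude.rapidDecay hu.row_decay p).summable_mul
      (hu.amplitude.rapidDecay hu.row_decay p))
    (hu.amplitude.gram hu.row_decay hu.row_norm)
  set V' : TwoMode →L[ℂ] TwoMode := V.toContinuousLinearMap
  set W' : TwoMode →L[ℂ] TwoMode := W.toContinuousLinearMap
  -- `V` is built from the columns of the real kernel and `W` from its rows, so they are adjoint; as
  -- both are isometries, `V` is unitary.
  have hVW : V'.adjoint = W' := by
    refine ext_ket₂ fun p => lp.ext (funext fun q => ?_)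
    rw [← inner_ket₂_left, ← inner_ket₂_left, ContinuousLinearMap.adjoint_inner_right,
      ← inner_conj_symm]
    change (starRingEnd ℂ) ⟪ket₂ p, V (ket₂ q)⟫_ℂ = ⟪ket₂ q, W (ket₂ p)⟫_ℂ
    rw [hV, hW, Complex.conj_ofReal]
  have hV1 : V'.adjoint ∘L V' = 1 :=
    (ContinuousLinearMap.norm_map_iff_adjoint_comp_self V').mp V.norm_map
  have hW1 : W'.adjoint ∘L W' = 1 :=
    (ContinuousLinearMap.norm_map_iff_adjoint_comp_self W').mp W.norm_map
  rw [← hVW, ContinuousLinearMap.adjoint_adjoint] at hW1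
  exact ⟨V', isGaussianUnitary_of_isAmplitude (Unitary.mem_iff.mpr ⟨hV1, hW1⟩)
    (fun p q => hV q p) hu.amplitude hu.vacuum_pos⟩

/-- The matrix elements of the Gaussian unitary are given by the kernel. -/
lemma inner_eq (hu : IsGaussianKernel α β u) (hU : IsGaussianUnitary α β U) (p q : ℕ × ℕ) :
    ⟪ket₂ p, U (ket₂ q)⟫_ℂ = (u p q : ℂ) := by
  obtain ⟨c, hc, hvac⟩ := hU.vacuum
  -- The vacuum amplitude is real, so the imaginary kernel vanishes there and hence everywhere.
  have him : ∀ p q, (⟪ket₂ p, U (ket₂ q)⟫_ℂ).im = 0 :=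
    hU.isAmplitude_im.eq_zero hu.isUnit_det (by simp [hvac])
  have h0 := hu.vacuum_pos
  set d := c / u (0, 0) (0, 0) with hd
  have hre : ∀ p q, (⟪ket₂ p, U (ket₂ q)⟫_ℂ).re = d * u p q := fun p q =>
    sub_eq_zero.mp ((hU.isAmplitude_re.sub_smul hu.amplitude d).eq_zero hu.isUnit_det
      (by simp [hvac, hd, h0.ne']) p q)
  have hel : ∀ p q, ⟪ket₂ p, U (ket₂ q)⟫_ℂ = ((d * u p q : ℝ) : ℂ) := fun p q =>
    Complex.ext (by simpa using hre p q) (by simpa using him p q)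
  have hn : ‖U (ket₂ (0, 0))‖ = 1 := by
    rw [← norm_ket₂ (0, 0)]
    exact (ContinuousLinearMap.norm_map_iff_adjoint_comp_self U).mpr
      (Unitary.mem_iff.mp hU.unitary).1 _
  have hd1 : d = 1 := by
    -- The image of the vacuum has norm one, as does the vacuum column of `u`; so `d ^ 2 = 1`, with
    -- `d > 0`.
    have h := lp.norm_rpow_eq_tsum (p := 2) (by simp) (U (ket₂ (0, 0)))
    simp only [hn, ← inner_ket₂_left, hel] at h
    simp [mul_pow, tsum_mul_left, hu.col_norm] at h
    have : 0 < d := by positivity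
    nlinarith
  rw [hel, hd1, one_mul]

end IsGaussianKernel

end Kernel

/-! ### The three kernels -/

/-- These are the coefficients of a two-mode squeezed vacuum, which decay geometrically. -/
lemma rapidDecay_diagonal (c : ℝ) {x : ℝ} (hx : |x| < 1) :
    RapidDecay (fun p => if p.1 = p.2 then c * x ^ p.1 else 0) := by
  intro k
  have hinj : Function.Injective (fun m : ℕ => (m, m)) := fun a b h => congrArg Prod.fst h
  rw [← hinj.summable_iff]
  · have h1 := (summable_pow_mul_geometric_of_norm_lt_one k
      (show ‖|x|‖ < 1 by simpa using hx)).mul_left (3 ^ k * |c|)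
    have h2 := (summable_geometric_of_lt_one (abs_nonneg x) hx).mul_left |c|
    refine Summable.of_nonneg_of_le (fun m => by simp only [Function.comp_apply]; positivity)
      (fun m => ?_) (h1.add h2)
    simp only [Function.comp_apply, if_true, abs_mul, abs_pow]
    -- For `m ≥ 1` one has `2m + 1 ≤ 3m`; the extra `1` covers `m = 0`.
    have h3 : ((m + m + 1 : ℕ) : ℝ) ^ k ≤ 3 ^ k * (m : ℝ) ^ k + 1 := by
      rcases m with _ | m
      · simp
      · rw [← mul_pow]
        have : (((m + 1) + (m + 1) + 1 : ℕ) : ℝ) ≤ 3 * ((m + 1 : ℕ) : ℝ) := by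
          push_cast; linarith [(Nat.cast_nonneg m : (0 : ℝ) ≤ m)]
        exact (pow_le_pow_left₀ (by positivity) this k).trans (by linarith)
    calc _ ≤ (3 ^ k * (m : ℝ) ^ k + 1) * (|c| * |x| ^ m) := by gcongr
      _ = _ := by ring
  · rintro ⟨m, n⟩ hp
    have : m ≠ n := by rintro rfl; exact hp ⟨m, rfl⟩
    simp [this]

lemma tsum_diagonal_sq {c x : ℝ} (hc : c ≠ 0) (h : c ^ 2 + x ^ 2 = 1) :
    ∑' p : ℕ × ℕ, (if p.1 = p.2 then c * x ^ p.1 else 0) ^ 2 = 1 := by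
  have hinj : Function.Injective (fun m : ℕ => (m, m)) := fun a b h => congrArg Prod.fst h
  rw [← hinj.tsum_eq]
  · have hx : x ^ 2 < 1 := by
      have : 0 < c ^ 2 := by positivity
      linarith
    simp only [if_true, mul_pow, ← pow_mul]
    simp only [mul_comm _ 2, pow_mul]
    rw [tsum_mul_left, tsum_geometric_of_lt_one (sq_nonneg x) hx,
      show 1 - x ^ 2 = c ^ 2 by linarith]
    exact mul_inv_cancel₀ (by positivity)
  · rintro ⟨m, n⟩ hp
    by_contra h'
    have : m ≠ n := by rintro rfl; exact h' ⟨m, rfl⟩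
    simp [this] at hp

/-- The vacuum is fixed; it is written as a geometric diagonal of ratio `0` so that the estimates
for squeezed vacua apply. -/
lemma beamAmplitude_vacuum_right (c s : ℝ) (p : ℕ × ℕ) :
    beamAmplitude c s p (0, 0) = if p.1 = p.2 then 1 * 0 ^ p.1 else 0 := by
  obtain ⟨m, n⟩ := p
  rcases m with _ | m <;> rcases n with _ | n <;>
    simp [beamAmplitude, transferCoeff, transferPoly, (fockNorm_pos _).ne']

lemma beamAmplitude_vacuum_left (c s : ℝ) (q : ℕ × ℕ) :
    beamAmplitude c s (0, 0) q = if q.1 = q.2 then 1 * 0 ^ q.1 else 0 := by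
  obtain ⟨m, n⟩ := q
  rcases m with _ | m <;> rcases n with _ | n <;>
    simp [beamAmplitude, transferCoeff, transferPoly, (fockNorm_pos _).ne']

lemma squeezeAmplitude_vacuum_right (c t : ℝ) (p : ℕ × ℕ) :
    squeezeAmplitude c t p (0, 0) = if p.1 = p.2 then c * t ^ p.1 else 0 := by
  obtain ⟨m, n⟩ := p
  by_cases h : m = n
  · subst h
    have : fockNorm (m, 0) / fockNorm (0, m) = 1 := by
      rw [show fockNorm (m, 0) = fockNorm (0, m) by simp [fockNorm],
        div_self (fockNorm_pos _).ne']
    simp [squeezeAmplitude, beamAmplitude, transferCoeff, transferPoly, this, coeff_linear_pow]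
  · simp [squeezeAmplitude, beamAmplitude, transferCoeff, h, Ne.symm h]

lemma squeezeAmplitude_vacuum_left (c t : ℝ) (q : ℕ × ℕ) :
    squeezeAmplitude c t (0, 0) q = if q.1 = q.2 then c * (-t) ^ q.1 else 0 := by
  obtain ⟨m, n⟩ := q
  by_cases h : m = n
  · subst h
    have : fockNorm (0, m) / fockNorm (m, 0) = 1 := by
      rw [show fockNorm (m, 0) = fockNorm (0, m) by simp [fockNorm],
        div_self (fockNorm_pos _).ne']
    rw [squeezeAmplitude, beamAmplitude, transferCoeff, transferPoly]
    simp only [this, pow_zero, mul_one, coeff_linear_pow]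
    simp
  · simp [squeezeAmplitude, beamAmplitude, transferCoeff, h]

lemma isGaussianKernel_beamAmplitude {c s : ℝ} (h : c ^ 2 + s ^ 2 = 1) :
    IsGaussianKernel !![c, -s; s, c] 0 (beamAmplitude c s) where
  amplitude := isAmplitude_beamAmplitude h
  symplectic := by
    ext i j
    fin_cases i <;> fin_cases j <;> simp [Matrix.mul_apply, Fin.sum_univ_two] <;>
      first | ring1 | linear_combination h
  symmetric := by simp
  isUnit_det := by
    rw [Matrix.det_fin_two_of, show c * c - -s * s = 1 by linear_combination h]
    exact isUnit_one
  vacuum_pos := by simp [beamAmplitude_vacuum_left]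
  row_decay := by
    rw [show beamAmplitude c s (0, 0) = _ from funext (beamAmplitude_vacuum_left c s)]
    exact rapidDecay_diagonal 1 (by simp)
  row_norm := by
    simp only [beamAmplitude_vacuum_left]
    exact tsum_diagonal_sq one_ne_zero (by simp)
  col_decay := by
    simp only [beamAmplitude_vacuum_right]
    exact rapidDecay_diagonal 1 (by simp)
  col_norm := by
    simp only [beamAmplitude_vacuum_right]
    exact tsum_diagonal_sq one_ne_zero (by simp)

section Squeeze

variable {c t : ℝ}

lemma abs_lt_one_of_sq_add_sq (hc : 0 < c) (h : c ^ 2 + t ^ 2 = 1) : |t| < 1 := by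
  rw [← sq_lt_one_iff_abs_lt_one]
  have : 0 < c ^ 2 := by positivity
  linarith

lemma isGaussianKernel_squeezeAmplitude (hc : 0 < c) (h : c ^ 2 + t ^ 2 = 1) :
    IsGaussianKernel !![c⁻¹, 0; 0, c⁻¹] !![0, t * c⁻¹; t * c⁻¹, 0] (squeezeAmplitude c t) where
  amplitude := isAmplitude_squeezeAmplitude hc.ne' h
  symplectic := by
    have := hc.ne'
    ext i j
    fin_cases i <;> fin_cases j <;> simp [Matrix.mul_apply, Fin.sum_univ_two] <;> field_simp <;>
      linear_combination -h
  symmetric := by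
    ext i j
    fin_cases i <;> fin_cases j <;> simp [Matrix.mul_apply, Fin.sum_univ_two] <;> ring
  isUnit_det := by
    rw [Matrix.det_fin_two_of, isUnit_iff_ne_zero]
    simp [hc.ne']
  vacuum_pos := by simpa [squeezeAmplitude_vacuum_left] using hc
  row_decay := by
    rw [show squeezeAmplitude c t (0, 0) = _ from funext (squeezeAmplitude_vacuum_left c t)]
    exact rapidDecay_diagonal c (by simpa using abs_lt_one_of_sq_add_sq hc h)
  row_norm := by
    simp only [squeezeAmplitude_vacuum_left]
    exact tsum_diagonal_sq hc.ne' (by simpa using h)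
  col_decay := by
    simp only [squeezeAmplitude_vacuum_right]
    exact rapidDecay_diagonal c (abs_lt_one_of_sq_add_sq hc h)
  col_norm := by
    simp only [squeezeAmplitude_vacuum_right]
    exact tsum_diagonal_sq hc.ne' h

lemma conjAmplitude_vacuum_left (c t : ℝ) (q : ℕ × ℕ) :
    conjAmplitude c t (0, 0) q = squeezeAmplitude c t (0, 0) q := by
  rw [conjAmplitude, squeezeAmplitude_vacuum_left, squeezeAmplitude_vacuum_left]
  by_cases h : q.1 = q.2
  · simp [h]
  · simp [h, Ne.symm h]

lemma isGaussianKernel_conjAmplitude (hc : 0 < c) (h : c ^ 2 + t ^ 2 = 1) :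
    IsGaussianKernel !![0, c⁻¹; c⁻¹, 0] !![t * c⁻¹, 0; 0, t * c⁻¹] (conjAmplitude c t) := by
  have hS := isGaussianKernel_squeezeAmplitude hc h
  have hrow := funext (conjAmplitude_vacuum_left c t)
  exact
  { amplitude := isAmplitude_conjAmplitude hc.ne' h
    symplectic := by
      have := hc.ne'
      ext i j
      fin_cases i <;> fin_cases j <;> simp [Matrix.mul_apply, Fin.sum_univ_two] <;> field_simp <;>
        linear_combination -h
    symmetric := by
      ext i j
      fin_cases i <;> fin_cases j <;> simp [Matrix.mul_apply, Fin.sum_univ_two] <;> ring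
    isUnit_det := by
      rw [Matrix.det_fin_two_of, isUnit_iff_ne_zero]
      simp [hc.ne']
    vacuum_pos := hS.vacuum_pos
    row_decay := by simpa only [hrow] using hS.row_decay
    row_norm := by simpa only [hrow] using hS.row_norm
    col_decay := hS.col_decay
    col_norm := hS.col_norm }

end Squeeze

/-! ### Kraus operators -/

lemma withEnv_ket (k j : ℕ) : withEnv k (ket j) = ket₂ (j, k) := by
  change (orthogonalFamily_ket₂ k).linearIsometry (lp.single 2 j (1 : ℂ)) = _
  rw [OrthogonalFamily.linearIsometry_apply_single]
  simp

lemma inner_ket_kraus (U : TwoMode →L[ℂ] TwoMode) (n ℓ m j : ℕ) :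
    ⟪ket m, kraus U n ℓ (ket j)⟫_ℂ = ⟪ket₂ (m, ℓ), U (ket₂ (j, n))⟫_ℂ := by
  change ⟪ket m, (withEnv ℓ).adjoint (U (withEnv n (ket j)))⟫_ℂ = _
  rw [ContinuousLinearMap.adjoint_inner_right, withEnv_ket, withEnv_ket]

section Diagonal

variable {P : ℕ → Prop} [DecidablePred P] {f : ℕ → ℕ} {w : ℕ → ℝ}

/-- If `F` maps Fock states to multiples of distinct Fock states, `F† F` is diagonal. -/
lemma isFockDiagonal_adjoint_comp_self {F : Mode →L[ℂ] Mode}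
    (hf : ∀ i j, P i → P j → f i = f j → i = j)
    (hF : ∀ j, F (ket j) = if P j then (w j : ℂ) • ket (f j) else 0) :
    IsFockDiagonal (F.adjoint ∘L F) (fun j => if P j then w j ^ 2 else 0) := by
  have hW : ∀ j, (F.adjoint ∘L F) (ket j) =
      (((if P j then w j ^ 2 else 0 : ℝ)) : ℂ) • ket j := by
    intro j
    refine lp.ext (funext fun i => ?_)
    rw [← inner_ket_left, ContinuousLinearMap.comp_apply, ContinuousLinearMap.adjoint_inner_right,
      lp.coeFn_smul, Pi.smul_apply, ket_apply, hF, hF]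
    by_cases hi : P i <;> by_cases hj : P j
    · simp only [if_pos hi, if_pos hj, inner_smul_left, inner_smul_right, Complex.conj_ofReal,
        inner_ket_left, ket_apply]
      by_cases hij : i = j
      · subst hij
        simp [sq]
      · have : f i ≠ f j := fun h => hij (hf i j hi hj h)
        simp [hij, this]
    · simp [hj]
    · have : i ≠ j := by rintro rfl; exact hi hj
      simp [hi, this]
    · simp [hj]
  intro x
  refine ((hasSum_ket x).mapL (F.adjoint ∘L F)).congr_fun fun j => ?_
  rw [map_smul, hW, inner_ket_left, smul_smul, mul_comm]

/-- Conservation leaves at most one output `f j` for each input `j`; `P j` says that this output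
exists, and `d` is the square of the amplitude in the form wanted. -/
lemma kraus_spec {U : TwoMode →L[ℂ] TwoMode} {n ℓ : ℕ} {d : ℕ → ℝ}
    (hU : ∀ m j, ⟪ket₂ (m, ℓ), U (ket₂ (j, n))⟫_ℂ = if P j ∧ m = f j then (w j : ℂ) else 0)
    (hf : ∀ i j, P i → P j → f i = f j → i = j) (hd : ∀ j, P j → w j ^ 2 = d j) :
    (∀ j, kraus U n ℓ (ket j) = if P j then (w j : ℂ) • ket (f j) else 0) ∧
      (quad U n ℓ).IsPositive ∧
      IsFockDiagonal (quad U n ℓ) (fun j => if P j then d j else 0) := by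
  have hF : ∀ j, kraus U n ℓ (ket j) = if P j then (w j : ℂ) • ket (f j) else 0 := by
    intro j
    refine lp.ext (funext fun m => ?_)
    rw [← inner_ket_left, inner_ket_kraus, hU]
    by_cases hj : P j
    · rw [if_pos hj, lp.coeFn_smul, Pi.smul_apply, ket_apply]
      simp [hj]
    · simp [hj]
  refine ⟨hF, ContinuousLinearMap.isPositive_adjoint_comp_self _, ?_⟩
  have : (fun j => if P j then d j else 0) = fun j => if P j then w j ^ 2 else 0 := by
    funext j
    split_ifs with hj
    · exact (hd j hj).symm
    · rfl
  rw [this]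
  exact isFockDiagonal_adjoint_comp_self hf hF

end Diagonal

lemma fockNorm_div (m n k l : ℕ) :
    fockNorm (m, n) / fockNorm (k, l) =
      √(((m ! : ℝ) * (n ! : ℝ)) / ((k ! : ℝ) * (l ! : ℝ))) := by
  rw [fockNorm, fockNorm, Real.sqrt_div (by positivity)]

/-- With `c = κ⁻¹` and `t = √(1 - κ⁻²)` one gets `c⁻¹ = κ` and `t / c = √(κ² - 1)`. -/
lemma amplifier {κ : ℝ} (hκ : 1 ≤ κ) :
    IsGaussianKernel !![κ, 0; 0, κ] !![0, √(κ ^ 2 - 1); √(κ ^ 2 - 1), 0]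
      (squeezeAmplitude κ⁻¹ √(1 - κ⁻¹ ^ 2)) := by
  have h0 : 0 < κ := by linarith
  have h1 : κ⁻¹ ^ 2 ≤ 1 := pow_le_one₀ (by positivity) (inv_le_one_of_one_le₀ hκ)
  have h := isGaussianKernel_squeezeAmplitude (c := κ⁻¹) (t := √(1 - κ⁻¹ ^ 2)) (by positivity)
    (by rw [Real.sq_sqrt (by linarith)]; ring)
  have e : √(1 - κ⁻¹ ^ 2) * κ = √(κ ^ 2 - 1) := by
    nth_rw 2 [← Real.sqrt_sq h0.le]
    rw [← Real.sqrt_mul (by linarith)]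
    congr 1
    field_simp
  rwa [inv_inv, e] at h

lemma phaseConjugator (κ : ℝ) :
    IsGaussianKernel !![0, √(1 + κ ^ 2); √(1 + κ ^ 2), 0] !![κ, 0; 0, κ]
      (conjAmplitude (√(1 + κ ^ 2))⁻¹ (κ / √(1 + κ ^ 2))) := by
  have h0 : 0 < √(1 + κ ^ 2) := by positivity
  have hs : √(1 + κ ^ 2) ^ 2 = 1 + κ ^ 2 := Real.sq_sqrt (by positivity)
  have h := isGaussianKernel_conjAmplitude (c := (√(1 + κ ^ 2))⁻¹) (t := κ / √(1 + κ ^ 2))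
    (by positivity) (by rw [inv_pow, div_pow, hs]; field_simp)
  rwa [inv_inv, div_mul_cancel₀ _ h0.ne'] at h

end PhotonAdded

end

theorem mainTheorem12 :
    -- photon-added amplifier
    (∀ κ : ℝ, 1 ≤ κ →
      (∃ U, PhotonAdded.IsTwoModeSqueezer κ U) ∧
      ∀ U, PhotonAdded.IsTwoModeSqueezer κ U → ∀ n ℓ : ℕ,
        (∀ j : ℕ, PhotonAdded.kraus U n ℓ (PhotonAdded.ket j) =
          if n ≤ j + ℓ then
            ((κ⁻¹ * √(((j ! : ℝ) * (ℓ ! : ℝ)) / (((j + ℓ - n) ! : ℝ) * (n ! : ℝ))) *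
              PhotonAdded.g₁ n j (j + ℓ - n) κ : ℝ) : ℂ) • PhotonAdded.ket (j + ℓ - n)
          else 0) ∧
        (PhotonAdded.quad U n ℓ).IsPositive ∧
        PhotonAdded.IsFockDiagonal (PhotonAdded.quad U n ℓ) (fun j =>
          if n ≤ j + ℓ then
            κ⁻¹ ^ 2 * (((j ! : ℝ) * (ℓ ! : ℝ)) / (((j + ℓ - n) ! : ℝ) * (n ! : ℝ))) *
              PhotonAdded.g₁ n j (j + ℓ - n) κ ^ 2
          else 0)) ∧
    -- photon-added attenuator
    (∀ κ : ℝ, 0 ≤ κ → κ ≤ 1 →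
      (∃ U, PhotonAdded.IsBeamSplitter κ U) ∧
      ∀ U, PhotonAdded.IsBeamSplitter κ U → ∀ n ℓ : ℕ,
        (∀ j : ℕ, PhotonAdded.kraus U n ℓ (PhotonAdded.ket j) =
          if ℓ ≤ j + n then
            ((√((((j + n - ℓ) ! : ℝ) * (ℓ ! : ℝ)) / ((j ! : ℝ) * (n ! : ℝ))) *
              PhotonAdded.g₂ n ℓ j κ : ℝ) : ℂ) • PhotonAdded.ket (j + n - ℓ)
          else 0) ∧
        (PhotonAdded.quad U n ℓ).IsPositive ∧
        PhotonAdded.IsFockDiagonal (PhotonAdded.quad U n ℓ) (fun j =>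
          if ℓ ≤ j + n then
            ((((j + n - ℓ) ! : ℝ) * (ℓ ! : ℝ)) / ((j ! : ℝ) * (n ! : ℝ))) *
              PhotonAdded.g₂ n ℓ j κ ^ 2
          else 0)) ∧
    -- photon-added phase conjugator
    (∀ κ : ℝ, 0 ≤ κ →
      (∃ U, PhotonAdded.IsPhaseConjugator κ U) ∧
      ∀ U, PhotonAdded.IsPhaseConjugator κ U → ∀ n ℓ : ℕ,
        (∀ j : ℕ, PhotonAdded.kraus U n ℓ (PhotonAdded.ket j) =
          if j ≤ ℓ + n then
            (((√(1 + κ ^ 2))⁻¹ * √(((n ! : ℝ) * (ℓ ! : ℝ)) / (((ℓ + n - j) ! : ℝ) * (j ! : ℝ))) *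
              PhotonAdded.g₃ n j (ℓ + n - j) κ : ℝ) : ℂ) • PhotonAdded.ket (ℓ + n - j)
          else 0) ∧
        (PhotonAdded.quad U n ℓ).IsPositive ∧
        PhotonAdded.IsFockDiagonal (PhotonAdded.quad U n ℓ) (fun j =>
          if j ≤ ℓ + n then
            (1 + κ ^ 2)⁻¹ * (((n ! : ℝ) * (ℓ ! : ℝ)) / (((ℓ + n - j) ! : ℝ) * (j ! : ℝ))) *
              PhotonAdded.g₃ n j (ℓ + n - j) κ ^ 2
          else 0)) := by
  refine ⟨fun κ hκ => ?_, fun κ h0 h1 => ?_, fun κ _ => ?_⟩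
  · have hK := PhotonAdded.amplifier hκ
    refine ⟨hK.exists_unitary, fun U hU n ℓ => PhotonAdded.kraus_spec (fun m j => ?_)
      (fun i j hi hj h => by omega) (fun j _ => ?_)⟩
    · rw [hK.inner_eq hU, PhotonAdded.squeezeAmplitude, PhotonAdded.beamAmplitude,
        PhotonAdded.transferCoeff]
      -- The difference of the photon numbers is conserved.
      by_cases h : ℓ + j = n + m
      · obtain rfl : m = j + ℓ - n := by omega
        rw [if_pos h, if_pos ⟨by omega, rfl⟩, PhotonAdded.g₁_eq, PhotonAdded.fockNorm_div,
          mul_comm (ℓ ! : ℝ), mul_comm (n ! : ℝ), mul_assoc]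
      · rw [if_neg h, if_neg (by omega)]
        simp
    · rw [mul_pow, mul_pow, Real.sq_sqrt (by positivity)]
  · have hK := PhotonAdded.isGaussianKernel_beamAmplitude (c := κ) (s := √(1 - κ ^ 2))
      (by rw [Real.sq_sqrt (by nlinarith)]; ring)
    refine ⟨hK.exists_unitary, fun U hU n ℓ => PhotonAdded.kraus_spec (fun m j => ?_)
      (fun i j hi hj h => by omega) (fun j _ => ?_)⟩
    · rw [hK.inner_eq hU, PhotonAdded.beamAmplitude, PhotonAdded.transferCoeff]
      by_cases h : m + ℓ = j + n
      · obtain rfl : m = j + n - ℓ := by omega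
        rw [if_pos h, if_pos ⟨by omega, rfl⟩, PhotonAdded.g₂_eq, PhotonAdded.fockNorm_div]
      · rw [if_neg h, if_neg (by omega)]
        simp
    · rw [mul_pow, Real.sq_sqrt (by positivity)]
  · have hK := PhotonAdded.phaseConjugator κ
    refine ⟨hK.exists_unitary, fun U hU n ℓ => PhotonAdded.kraus_spec (fun m j => ?_)
      (fun i j hi hj h => by omega) (fun j _ => ?_)⟩
    · rw [hK.inner_eq hU, PhotonAdded.conjAmplitude, PhotonAdded.squeezeAmplitude,
        PhotonAdded.beamAmplitude, PhotonAdded.transferCoeff]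
      simp only [Prod.fst_swap, Prod.snd_swap]
      -- The difference of the photon numbers changes sign.
      by_cases h : ℓ + n = j + m
      · obtain rfl : m = ℓ + n - j := by omega
        rw [if_pos h, if_pos ⟨by omega, rfl⟩, PhotonAdded.g₃_eq, PhotonAdded.fockNorm_div,
          mul_comm (ℓ ! : ℝ), mul_comm (j ! : ℝ), mul_assoc]
      · rw [if_neg h, if_neg (by omega)]
        simp
    · rw [mul_pow, mul_pow, Real.sq_sqrt (by positivity), inv_pow, Real.sq_sqrt (by positivity)]
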